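/- **Proposition 3.1.** For an $n\times n$ complex matrix $A$ let $a(A)$ (the ascent) be the smallest integer $k\ge 0$ with $\ker A^k=\ker A^{k+1}$, and let $$p(A)=\sup\{k\ge 0 : I, A, A^2,\dots,A^k \text{ are all partial isometries}\}\in\{0,1,2,\dots\}\cup\{\infty\},$$ where a matrix $B$ is a partial isometry if $\|Bx\|=\|x\|$ for all $x\in(\ker B)^{\perp}$ (Euclidean norm on $\mathbb{C}^n$). Let $J_n$ be the $n\times n$ matrix with ones on the first superdiagonal and zeros elsewhere. Call $A$ an $S_n$-matrix if $\|A\|\le 1$ (operator norm induced by the Euclidean norm), every eigenvalue $\lambda$ of $A$ satisfies $|\lambda|<1$, and $\operatorname{rank}(I_n-A^*A)=1$. Let $A$ be a noninvertible $S_n$-matrix. Then (a) $a(A)$ equals the algebraic multiplicity of the eigenvalue $0$ of $A$ (the multiplicity of $0$ as a root of the characteristic polynomial $\det(zI_n-A)$); (b) $p(A)=a(A)$ or $p(A)=\infty$; (c) $p(A)=\infty$ if and only if $A$ is unitarily similar to $J_n$; (d) $\operatorname{rank}A^j=n-j$ for $1\le j\le a(A)$. -/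

import Mathlib

namespace PPI

/-- An `n`-by-`n` complex matrix is a partial isometry if it preserves the Euclidean norm on the
orthogonal complement of its kernel. -/
def IsPartialIsometry {n : ℕ} (A : Matrix (Fin n) (Fin n) ℂ) : Prop :=
  ∀ x ∈ (LinearMap.ker (Matrix.toEuclideanLin A))ᗮ, ‖Matrix.toEuclideanLin A x‖ = ‖x‖

/-- The ascent `a(A)`: the minimal `k ≥ 0` with `ker A ^ k = ker A ^ (k + 1)`. Such a `k` exists for
every square matrix over `ℂ`, so the infimum is a minimum. -/
noncomputable def ascent {n : ℕ} (A : Matrix (Fin n) (Fin n) ℂ) : ℕ :=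
  sInf {k : ℕ | LinearMap.ker (Matrix.toEuclideanLin (A ^ k)) =
    LinearMap.ker (Matrix.toEuclideanLin (A ^ (k + 1)))}

/-- The power partial isometry index `p(A)`: the supremum, in `ℕ ∪ {∞}`, of all `k ≥ 0` such that
`I, A, A ^ 2, …, A ^ k` are all partial isometries. -/
noncomputable def ppiIndex {n : ℕ} (A : Matrix (Fin n) (Fin n) ℂ) : ℕ∞ :=
  sSup {m : ℕ∞ | ∃ k : ℕ, m = (k : ℕ∞) ∧ ∀ j : ℕ, j ≤ k → IsPartialIsometry (A ^ j)}

/-- The `n`-by-`n` nilpotent Jordan block `J_n`, with ones on the superdiagonal. -/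
def jordanBlock (n : ℕ) : Matrix (Fin n) (Fin n) ℂ :=
  Matrix.of fun i j => if (i : ℕ) + 1 = (j : ℕ) then 1 else 0

/-- Unitary similarity of complex matrices. -/
def UnitarilySimilar {n : ℕ} (A B : Matrix (Fin n) (Fin n) ℂ) : Prop :=
  ∃ U ∈ Matrix.unitaryGroup (Fin n) ℂ, A = U * B * star U

/-- The class `S_n`: contractions (for the operator norm of the Euclidean norm) with all eigenvalues
in the open unit disc and `rank (I - A* A) = 1`. -/
structure IsClassS {n : ℕ} (A : Matrix (Fin n) (Fin n) ℂ) : Prop where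
  contraction : ‖Matrix.toEuclideanCLM (n := Fin n) (𝕜 := ℂ) A‖ ≤ 1
  eigenvalue_lt : ∀ z : ℂ, Module.End.HasEigenvalue (Matrix.toEuclideanLin A) z → ‖z‖ < 1
  defect_rank : (1 - A.conjTranspose * A).rank = 1

end PPI

/-! Let `T` be the operator of `A`, and let `M_j` be the isometric part of `T ^ j`, the subspace
where the contraction `T ^ j` preserves norms. Always `M_j ≤ (ker T ^ j)ᗮ`, and `T ^ j` is a partial
isometry exactly when equality holds. Defect rank one says `dim M_1 = n - 1`. Each further power
costs at most one dimension, so `dim M_j ≥ n - j`. Singularity makes `ker T` a line, so `dim ker T ^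
j = j` up to the ascent `a`. Dimensions then force equality for `j ≤ a` (`isometricPart_pow_eq`),
giving `p ≥ a`; the kernel dimensions also give the ranks and the multiplicity of `0`. If `T ^ (a +
1)` is a partial isometry as well, `T` is isometric on the invariant subspace `range (T ^ a)`; with
no unimodular eigenvalue this is zero (`pow_eq_zero_of_isometric`). Then `a = n`, and the orbit of a
unit vector of `M_(n-1)` is an orthonormal basis shifted by `T`. Conversely, if `A` is nilpotent,
every power past `a` vanishes, so all powers are partial isometries. -/

open Module

namespace PPI

/-! ### Kernels of powers of a linear map. -/

section LinearAlgebra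

variable {K V W : Type*} [Field K] [AddCommGroup V] [Module K V] [AddCommGroup W] [Module K W]

theorem finrank_map_add_finrank_inf_ker [FiniteDimensional K V] (g : V →ₗ[K] W)
    (q : Submodule K V) :
    finrank K (q.map g) + finrank K (q ⊓ LinearMap.ker g : Submodule K V) = finrank K q := by
  have h := (g.domRestrict q).finrank_range_add_finrank_ker
  rw [LinearMap.range_domRestrict, LinearMap.ker_domRestrict,
    ← Submodule.finrank_map_subtype_eq q, Submodule.map_comap_subtype] at h
  exact h

/-- `T ^ j` sends `ker (T ^ (j + 1))` into `ker T`; apply rank-nullity to this restriction. -/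
theorem finrank_ker_pow_succ_le [FiniteDimensional K V] (T : V →ₗ[K] V) (j : ℕ) :
    finrank K (LinearMap.ker (T ^ (j + 1))) ≤
      finrank K (LinearMap.ker (T ^ j)) + finrank K (LinearMap.ker T) := by
  rw [← finrank_map_add_finrank_inf_ker (T ^ j) (LinearMap.ker (T ^ (j + 1))), add_comm]
  refine add_le_add (Submodule.finrank_mono inf_le_right) (Submodule.finrank_mono ?_)
  rintro _ ⟨x, hx, rfl⟩
  simpa [pow_succ'] using hx

theorem ker_pow_mono (T : V →ₗ[K] V) {i j : ℕ} (h : i ≤ j) :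
    LinearMap.ker (T ^ i) ≤ LinearMap.ker (T ^ j) := by
  intro x hx
  obtain ⟨k, rfl⟩ := Nat.exists_eq_add_of_le' h
  rw [LinearMap.mem_ker] at hx ⊢
  rw [pow_add, Module.End.mul_apply, hx, map_zero]

theorem ker_pow_eq_of_le {T : V →ₗ[K] V} {a j : ℕ}
    (ha : LinearMap.ker (T ^ a) = LinearMap.ker (T ^ (a + 1))) (h : a ≤ j) :
    LinearMap.ker (T ^ j) = LinearMap.ker (T ^ a) := by
  obtain ⟨k, rfl⟩ := Nat.exists_eq_add_of_le h
  exact (Module.End.ker_pow_constant ha k).symm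

/-- If the kernel of `T` is a line, the kernels of its powers grow by one dimension at each step
until they become stationary. -/
theorem finrank_ker_pow_eq [FiniteDimensional K V] {T : V →ₗ[K] V}
    (h1 : finrank K (LinearMap.ker T) = 1) {a : ℕ}
    (ha : ∀ k < a, LinearMap.ker (T ^ k) ≠ LinearMap.ker (T ^ (k + 1))) :
    ∀ j ≤ a, finrank K (LinearMap.ker (T ^ j)) = j := by
  intro j
  induction j with
  | zero => intro _; simp [Module.End.one_eq_id]
  | succ j ih =>
    intro hj
    have hlt := Submodule.finrank_lt_finrank_of_lt
      (lt_of_le_of_ne (ker_pow_mono T (Nat.le_succ j)) (ha j hj))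
    have hle := finrank_ker_pow_succ_le T j
    have := ih (by omega)
    simp only [Nat.succ_eq_add_one] at hlt
    omega

theorem rootMultiplicity_zero_charpoly_eq [FiniteDimensional K V] {T : V →ₗ[K] V} {a : ℕ}
    (ha : LinearMap.ker (T ^ a) = LinearMap.ker (T ^ (a + 1))) :
    T.charpoly.rootMultiplicity 0 = finrank K (LinearMap.ker (T ^ a)) := by
  rw [← LinearMap.finrank_maxGenEigenspace_eq]
  have h : Module.End.maxGenEigenspace T 0 = LinearMap.ker (T ^ a) := by
    rw [← Module.End.iSup_genEigenspace_eq]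
    simp only [Module.End.genEigenspace_nat, zero_smul, sub_zero]
    refine le_antisymm (iSup_le fun j => ?_) (le_iSup (fun j => LinearMap.ker (T ^ j)) a)
    rcases le_total j a with h | h
    · exact ker_pow_mono T h
    · exact (ker_pow_eq_of_le ha h).le
  rw [h]

end LinearAlgebra

/-! ### Isometric parts of contractions and their powers. -/

section InnerProduct

variable {E : Type*} [NormedAddCommGroup E] [InnerProductSpace ℂ E] [FiniteDimensional ℂ E]

/-- The kernel of the defect operator `1 - T* T`. For a contraction this is the set of vectors whose
norm `T` preserves. -/
noncomputable def isometricPart (T : E →ₗ[ℂ] E) : Submodule ℂ E :=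
  LinearMap.ker (1 - LinearMap.adjoint T * T)

theorem mem_isometricPart {T : E →ₗ[ℂ] E} {x : E} :
    x ∈ isometricPart T ↔ LinearMap.adjoint T (T x) = x := by
  rw [isometricPart, LinearMap.mem_ker, LinearMap.sub_apply, sub_eq_zero, eq_comm]
  rfl

theorem inner_map_map_of_mem_isometricPart {T : E →ₗ[ℂ] E} {x : E} (hx : x ∈ isometricPart T)
    (y : E) : inner ℂ (T x) (T y) = inner ℂ x y := by
  rw [← LinearMap.adjoint_inner_left, mem_isometricPart.1 hx]

theorem norm_map_of_mem_isometricPart {T : E →ₗ[ℂ] E} {x : E} (hx : x ∈ isometricPart T) :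
    ‖T x‖ = ‖x‖ := by
  have h := inner_map_map_of_mem_isometricPart hx x
  rw [inner_self_eq_norm_sq_to_K, inner_self_eq_norm_sq_to_K] at h
  have h' : ‖T x‖ ^ 2 = ‖x‖ ^ 2 := by exact_mod_cast h
  exact (sq_eq_sq₀ (norm_nonneg _) (norm_nonneg _)).1 h'

theorem norm_adjoint_le {T : E →ₗ[ℂ] E} (hT : ∀ x, ‖T x‖ ≤ ‖x‖) (x : E) :
    ‖LinearMap.adjoint T x‖ ≤ ‖x‖ := by
  have h : ‖LinearMap.adjoint T x‖ ^ 2 ≤ ‖LinearMap.adjoint T x‖ * ‖x‖ := by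
    calc ‖LinearMap.adjoint T x‖ ^ 2
        = RCLike.re (inner ℂ (LinearMap.adjoint T x) (LinearMap.adjoint T x)) :=
          norm_sq_eq_re_inner _
      _ = RCLike.re (inner ℂ (T (LinearMap.adjoint T x)) x) := by
          rw [LinearMap.adjoint_inner_right]
      _ ≤ ‖T (LinearMap.adjoint T x)‖ * ‖x‖ := re_inner_le_norm _ _
      _ ≤ _ := by gcongr; exact hT _
  rcases (norm_nonneg (LinearMap.adjoint T x)).eq_or_lt with h0 | h0
  · rw [← h0]; exact norm_nonneg x
  · nlinarith

theorem mem_isometricPart_iff_norm {T : E →ₗ[ℂ] E} (hT : ∀ x, ‖T x‖ ≤ ‖x‖) {x : E} :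
    x ∈ isometricPart T ↔ ‖T x‖ = ‖x‖ := by
  refine ⟨norm_map_of_mem_isometricPart, fun hx => mem_isometricPart.2 ?_⟩
  -- Expanding, `‖T*Tx - x‖² = ‖T*Tx‖² - 2‖Tx‖² + ‖x‖²`, which is at most `0` once `‖Tx‖ = ‖x‖`.
  have h := norm_sub_sq (𝕜 := ℂ) (LinearMap.adjoint T (T x)) x
  rw [LinearMap.adjoint_inner_left, ← norm_sq_eq_re_inner, hx] at h
  have h2 := (norm_adjoint_le hT (T x)).trans_eq hx
  have h3 : ‖LinearMap.adjoint T (T x)‖ ^ 2 ≤ ‖x‖ ^ 2 := by gcongr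
  have h4 : ‖LinearMap.adjoint T (T x) - x‖ ^ 2 ≤ 0 := by linarith
  have h5 : ‖LinearMap.adjoint T (T x) - x‖ = 0 := pow_eq_zero_iff two_ne_zero |>.1
    (le_antisymm h4 (sq_nonneg _))
  exact sub_eq_zero.1 (norm_eq_zero.1 h5)

theorem norm_pow_le {F : Type*} [NormedAddCommGroup F] [InnerProductSpace ℂ F]
    {T : F →ₗ[ℂ] F} (hT : ∀ x, ‖T x‖ ≤ ‖x‖) (j : ℕ) (x : F) :
    ‖(T ^ j) x‖ ≤ ‖x‖ := by
  induction j with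
  | zero => simp
  | succ j ih => rw [pow_succ', Module.End.mul_apply]; exact (hT _).trans ih

theorem isometricPart_inf_comap_le {T : E →ₗ[ℂ] E} (hT : ∀ x, ‖T x‖ ≤ ‖x‖) (j : ℕ) :
    isometricPart (T ^ j) ⊓ (isometricPart T).comap (T ^ j) ≤ isometricPart (T ^ (j + 1)) := by
  rintro x ⟨hx, hy⟩
  rw [mem_isometricPart_iff_norm (norm_pow_le hT _), pow_succ', Module.End.mul_apply,
    norm_map_of_mem_isometricPart hy, norm_map_of_mem_isometricPart hx]

theorem finrank_le_finrank_isometricPart_add {T : E →ₗ[ℂ] E} (hT : ∀ x, ‖T x‖ ≤ ‖x‖)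
    (h1 : finrank ℂ E ≤ finrank ℂ (isometricPart T) + 1) (j : ℕ) :
    finrank ℂ E ≤ finrank ℂ (isometricPart (T ^ j)) + j := by
  induction j with
  | zero =>
    have : isometricPart (T ^ 0) = ⊤ := by
      rw [eq_top_iff]; intro x _
      exact (mem_isometricPart_iff_norm (norm_pow_le hT 0)).2 (by simp)
    rw [this, finrank_top, add_zero]
  | succ j ih =>
    -- Modulo `isometricPart T`, the image of `T ^ j` lies in a space of dimension at most one, so
    -- passing to the kernel loses at most one dimension.
    have h := finrank_map_add_finrank_inf_ker ((isometricPart T).mkQ ∘ₗ (T ^ j))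
      (isometricPart (T ^ j))
    rw [LinearMap.ker_comp, Submodule.ker_mkQ] at h
    have h2 := Submodule.finrank_mono (isometricPart_inf_comap_le hT j)
    have h3 := Submodule.finrank_le
      ((isometricPart (T ^ j)).map ((isometricPart T).mkQ ∘ₗ (T ^ j)))
    have h4 := (isometricPart T).finrank_quotient_add_finrank
    omega

theorem isometricPart_le_orthogonal_ker (T : E →ₗ[ℂ] E) :
    isometricPart T ≤ (LinearMap.ker T)ᗮ := by
  intro x hx
  rw [Submodule.mem_orthogonal']
  intro y hy
  rw [← inner_map_map_of_mem_isometricPart hx, LinearMap.mem_ker.1 hy, inner_zero_right]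

theorem isometricPart_pow_eq {T : E →ₗ[ℂ] E} (hT : ∀ x, ‖T x‖ ≤ ‖x‖)
    (h1 : finrank ℂ E ≤ finrank ℂ (isometricPart T) + 1) {j : ℕ}
    (hj : finrank ℂ (LinearMap.ker (T ^ j)) = j) :
    isometricPart (T ^ j) = (LinearMap.ker (T ^ j))ᗮ := by
  refine Submodule.eq_of_le_of_finrank_le (isometricPart_le_orthogonal_ker _) ?_
  have h := finrank_le_finrank_isometricPart_add hT h1 j
  have h2 := (LinearMap.ker (T ^ j)).finrank_add_finrank_orthogonal
  omega

/-- A linear map without unimodular eigenvalues is not isometric on a nonzero invariant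
subspace. -/
theorem eq_bot_of_invariant_of_norm_eq {T : E →ₗ[ℂ] E}
    (hev : ∀ z : ℂ, Module.End.HasEigenvalue T z → ‖z‖ < 1) {q : Submodule ℂ E}
    (hq : ∀ x ∈ q, T x ∈ q) (hn : ∀ x ∈ q, ‖T x‖ = ‖x‖) : q = ⊥ := by
  by_contra hne
  have : Nontrivial q := Submodule.nontrivial_iff_ne_bot.2 hne
  obtain ⟨z, hz⟩ := Module.End.exists_eigenvalue (T.restrict hq)
  obtain ⟨v, hv⟩ := hz.exists_hasEigenvector
  have hv1 : T v = z • (v : E) := by simpa using congrArg Subtype.val hv.apply_eq_smul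
  have hv0 : (v : E) ≠ 0 := by simpa using hv.2
  have hz1 := hev z (Module.End.hasEigenvalue_of_hasEigenvector
    ⟨Module.End.mem_eigenspace_iff.2 hv1, hv0⟩)
  have h := hn v v.2
  rw [hv1, norm_smul] at h
  have := norm_pos_iff.2 hv0
  nlinarith

/-- If `T ^ a` and `T ^ (a + 1)` are both isometric off their common kernel and `T` has no
unimodular eigenvalue, then `T ^ a = 0`. -/
theorem pow_eq_zero_of_isometric {T : E →ₗ[ℂ] E}
    (hev : ∀ z : ℂ, Module.End.HasEigenvalue T z → ‖z‖ < 1) {a : ℕ}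
    (ha : LinearMap.ker (T ^ a) = LinearMap.ker (T ^ (a + 1)))
    (h0 : ∀ x ∈ (LinearMap.ker (T ^ a))ᗮ, ‖(T ^ a) x‖ = ‖x‖)
    (h1 : ∀ x ∈ (LinearMap.ker (T ^ (a + 1)))ᗮ, ‖(T ^ (a + 1)) x‖ = ‖x‖) : T ^ a = 0 := by
  rw [← LinearMap.range_eq_bot]
  refine eq_bot_of_invariant_of_norm_eq hev ?_ ?_
  · rintro _ ⟨x, rfl⟩
    refine ⟨T x, ?_⟩
    rw [← Module.End.mul_apply, ← Module.End.mul_apply, ← pow_succ, pow_succ']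
  -- Only the component `z` of `x` orthogonal to the kernel matters, and `‖T ^ (a + 1) z‖ = ‖z‖ = ‖T
  -- ^ a z‖`.
  · rintro _ ⟨x, rfl⟩
    obtain ⟨y, hy, z, hz, rfl⟩ := (LinearMap.ker (T ^ a)).exists_add_mem_mem_orthogonal x
    rw [map_add, LinearMap.mem_ker.1 hy, zero_add, h0 z hz, ← Module.End.mul_apply, ← pow_succ',
      h1 z (ha ▸ hz)]

/-- The orbit of a unit vector `x` on which `T ^ m` is isometric, when `T ^ (m + 1) = 0`, is
orthonormal. -/
theorem orthonormal_orbit {T : E →ₗ[ℂ] E} (hT : ∀ x, ‖T x‖ ≤ ‖x‖) {m : ℕ} (h0 : T ^ (m + 1) = 0)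
    {x : E} (hx : x ∈ isometricPart (T ^ m)) (hx1 : ‖x‖ = 1) :
    Orthonormal ℂ fun i : Fin (m + 1) => (T ^ (i : ℕ)) x := by
  have hn : ∀ i ≤ m, ‖(T ^ i) x‖ = 1 := by
    intro i hi
    -- Norms along the orbit decrease from `1` and are still `1` at step `m`.
    refine le_antisymm ((norm_pow_le hT i x).trans_eq hx1) ?_
    have h := norm_map_of_mem_isometricPart hx
    obtain ⟨k, rfl⟩ := Nat.exists_eq_add_of_le' hi
    rw [pow_add, Module.End.mul_apply, hx1] at h
    exact h ▸ norm_pow_le hT k _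
  have ho : ∀ i j, i < j → i ≤ m → inner ℂ ((T ^ i) x) ((T ^ j) x) = 0 := by
    intro i j hij hi
    obtain ⟨k, rfl⟩ := Nat.exists_eq_add_of_lt hij
    have hxi : x ∈ isometricPart (T ^ i) :=
      (mem_isometricPart_iff_norm (norm_pow_le hT i)).2 ((hn i hi).trans hx1.symm)
    -- Cancel `T ^ i` from both sides, then apply `T ^ m` to both: the second entry becomes `T ^ (m
    -- + k + 1) x = 0`.
    rw [show i + k + 1 = i + (k + 1) by ring, pow_add, Module.End.mul_apply,
      inner_map_map_of_mem_isometricPart hxi, ← inner_map_map_of_mem_isometricPart hx,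
      ← Module.End.mul_apply, ← pow_add, show m + (k + 1) = k + (m + 1) by ring, pow_add, h0]
    simp
  refine ⟨fun i => hn i (Nat.lt_succ_iff.1 i.2), fun i j hij => ?_⟩
  rcases lt_or_gt_of_ne (Fin.val_ne_of_ne hij) with h | h
  · exact ho i j h (Nat.lt_succ_iff.1 i.2)
  · rw [← inner_conj_symm, ho j i h (Nat.lt_succ_iff.1 j.2), map_zero]

end InnerProduct

/-! ### Transfer to matrices of class `S_n`. -/

section Matrix

variable {n : ℕ} {A : Matrix (Fin n) (Fin n) ℂ}

theorem toEuclideanLin_mul (A B : Matrix (Fin n) (Fin n) ℂ) :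
    Matrix.toEuclideanLin (A * B) = Matrix.toEuclideanLin A * Matrix.toEuclideanLin B := by
  simp only [← Matrix.coe_toEuclideanCLM_eq_toEuclideanLin, map_mul]
  rfl

theorem toEuclideanLin_one :
    Matrix.toEuclideanLin (1 : Matrix (Fin n) (Fin n) ℂ) = 1 := by
  simp only [← Matrix.coe_toEuclideanCLM_eq_toEuclideanLin, map_one]
  rfl

theorem toEuclideanLin_pow (A : Matrix (Fin n) (Fin n) ℂ) (k : ℕ) :
    Matrix.toEuclideanLin (A ^ k) = Matrix.toEuclideanLin A ^ k := by
  induction k with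
  | zero => rw [pow_zero, pow_zero, toEuclideanLin_one]
  | succ k ih => rw [pow_succ, pow_succ, toEuclideanLin_mul, ih]

theorem rank_eq_finrank_range_toEuclideanLin (B : Matrix (Fin n) (Fin n) ℂ) :
    B.rank = finrank ℂ (LinearMap.range (Matrix.toEuclideanLin B)) := by
  rw [Matrix.toEuclideanLin, Matrix.toLpLin_eq_toLin]
  exact Matrix.rank_eq_finrank_range_toLin B _ _

theorem charpoly_toEuclideanLin (B : Matrix (Fin n) (Fin n) ℂ) :
    (Matrix.toEuclideanLin B).charpoly = B.charpoly := by
  rw [Matrix.toEuclideanLin, Matrix.toLpLin_eq_toLin]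
  exact Matrix.charpoly_toLin B _

theorem ker_toEuclideanLin_ne_bot (hA : ¬ IsUnit A) :
    LinearMap.ker (Matrix.toEuclideanLin A) ≠ ⊥ := by
  intro h
  obtain ⟨T, hT⟩ := (LinearMap.isUnit_iff_ker_eq_bot _).2 h
  apply hA
  rw [Matrix.isUnit_iff_isUnit_det,
    ← LinearMap.det_toLin (EuclideanSpace.basisFun (Fin n) ℂ).toBasis]
  exact LinearMap.isUnit_det _ ⟨T, hT⟩

theorem ker_pow_ascent (A : Matrix (Fin n) (Fin n) ℂ) :
    LinearMap.ker (Matrix.toEuclideanLin A ^ ascent A) =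
      LinearMap.ker (Matrix.toEuclideanLin A ^ (ascent A + 1)) := by
  simp only [← toEuclideanLin_pow]
  refine Nat.sInf_mem (s := {k : ℕ | LinearMap.ker (Matrix.toEuclideanLin (A ^ k)) =
    LinearMap.ker (Matrix.toEuclideanLin (A ^ (k + 1)))}) ?_
  -- Nonemptiness is essential, since `sInf ∅ = 0` in `ℕ`.
  obtain ⟨k, -, hk⟩ := Module.End.exists_ker_pow_eq_ker_pow_succ (Matrix.toEuclideanLin A)
  exact ⟨k, by simpa only [Set.mem_ofPred_eq, toEuclideanLin_pow] using hk⟩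

theorem ker_pow_ne_of_lt_ascent {k : ℕ} (hk : k < ascent A) :
    LinearMap.ker (Matrix.toEuclideanLin A ^ k) ≠
      LinearMap.ker (Matrix.toEuclideanLin A ^ (k + 1)) := by
  simp only [← toEuclideanLin_pow]
  exact Nat.notMem_of_lt_sInf hk

theorem isPartialIsometry_zero : IsPartialIsometry (0 : Matrix (Fin n) (Fin n) ℂ) := by
  intro x hx
  rw [map_zero, LinearMap.ker_zero, Submodule.top_orthogonal_eq_bot, Submodule.mem_bot] at hx
  simp [hx]

theorem ppiIndex_eq_top_iff : ppiIndex A = ⊤ ↔ ∀ j, IsPartialIsometry (A ^ j) := by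
  constructor
  · intro h j
    have hj : (j : ℕ∞) < ppiIndex A := h ▸ ENat.natCast_lt_top j
    obtain ⟨_, ⟨k, rfl, hk⟩, hlt⟩ := lt_sSup_iff.1 hj
    exact hk j (by exact_mod_cast hlt.le)
  · intro h
    rw [ENat.eq_top_iff_forall_ge]
    exact fun k => le_sSup ⟨k, rfl, fun j _ => h j⟩

namespace IsClassS

theorem norm_le (hS : IsClassS A) (x : EuclideanSpace ℂ (Fin n)) :
    ‖Matrix.toEuclideanLin A x‖ ≤ ‖x‖ := by
  have h := (Matrix.toEuclideanCLM (n := Fin n) (𝕜 := ℂ) A).le_of_opNorm_le hS.contraction x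
  rwa [one_mul] at h

theorem finrank_isometricPart (hS : IsClassS A) :
    finrank ℂ (isometricPart (Matrix.toEuclideanLin A)) + 1 = n := by
  have h := hS.defect_rank
  rw [rank_eq_finrank_range_toEuclideanLin, map_sub, toEuclideanLin_mul, toEuclideanLin_one,
    Matrix.toEuclideanLin_conjTranspose_eq_adjoint] at h
  have h2 := LinearMap.finrank_range_add_finrank_ker
    (1 - LinearMap.adjoint (Matrix.toEuclideanLin A) * Matrix.toEuclideanLin A)
  rw [h, finrank_euclideanSpace_fin] at h2
  rw [isometricPart]
  omega

/-- The kernel is nonzero and orthogonal to a subspace of codimension one. -/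
theorem finrank_ker (hS : IsClassS A) (hA : ¬ IsUnit A) :
    finrank ℂ (LinearMap.ker (Matrix.toEuclideanLin A)) = 1 := by
  have h1 := hS.finrank_isometricPart
  have h2 := Submodule.finrank_mono (isometricPart_le_orthogonal_ker (Matrix.toEuclideanLin A))
  have h3 := (LinearMap.ker (Matrix.toEuclideanLin A)).finrank_add_finrank_orthogonal
  have h4 := Submodule.one_le_finrank_iff.2 (ker_toEuclideanLin_ne_bot hA)
  rw [finrank_euclideanSpace_fin] at h3
  omega

theorem finrank_ker_pow (hS : IsClassS A) (hA : ¬ IsUnit A) {j : ℕ} (hj : j ≤ ascent A) :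
    finrank ℂ (LinearMap.ker (Matrix.toEuclideanLin A ^ j)) = j :=
  finrank_ker_pow_eq (hS.finrank_ker hA) (fun _ => ker_pow_ne_of_lt_ascent) j hj

theorem isometricPart_pow (hS : IsClassS A) (hA : ¬ IsUnit A) {j : ℕ} (hj : j ≤ ascent A) :
    isometricPart (Matrix.toEuclideanLin A ^ j) =
      (LinearMap.ker (Matrix.toEuclideanLin A ^ j))ᗮ :=
  isometricPart_pow_eq hS.norm_le
    (by rw [hS.finrank_isometricPart, finrank_euclideanSpace_fin]) (hS.finrank_ker_pow hA hj)

theorem isPartialIsometry_pow (hS : IsClassS A) (hA : ¬ IsUnit A) {j : ℕ} (hj : j ≤ ascent A) :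
    IsPartialIsometry (A ^ j) := by
  intro x hx
  rw [toEuclideanLin_pow, ← hS.isometricPart_pow hA hj] at hx
  rw [toEuclideanLin_pow]
  exact norm_map_of_mem_isometricPart hx

theorem forall_isPartialIsometry_pow (hS : IsClassS A) (hA : ¬ IsUnit A)
    (h : A ^ ascent A = 0) (j : ℕ) : IsPartialIsometry (A ^ j) := by
  rcases le_total j (ascent A) with hj | hj
  · exact hS.isPartialIsometry_pow hA hj
  · rw [pow_eq_zero_of_le hj h]
    exact isPartialIsometry_zero

theorem pow_ascent_eq_zero (hS : IsClassS A) (hA : ¬ IsUnit A)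
    (h : IsPartialIsometry (A ^ (ascent A + 1))) : A ^ ascent A = 0 := by
  apply Matrix.toEuclideanLin.injective
  rw [map_zero, toEuclideanLin_pow]
  refine pow_eq_zero_of_isometric hS.eigenvalue_lt (ker_pow_ascent A) ?_ ?_
  · simpa only [IsPartialIsometry, toEuclideanLin_pow] using hS.isPartialIsometry_pow hA le_rfl
  · simpa only [IsPartialIsometry, toEuclideanLin_pow] using h

theorem ascent_eq (hS : IsClassS A) (hA : ¬ IsUnit A) (h : A ^ ascent A = 0) :
    ascent A = n := by
  have h1 := hS.finrank_ker_pow hA le_rfl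
  rw [← toEuclideanLin_pow, h, map_zero, LinearMap.ker_zero, finrank_top,
    finrank_euclideanSpace_fin] at h1
  exact h1.symm

end IsClassS

theorem pow_ascent_eq_zero_of_pow_eq_zero {k : ℕ} (h : A ^ k = 0) : A ^ ascent A = 0 := by
  apply Matrix.toEuclideanLin.injective
  rw [map_zero, toEuclideanLin_pow, ← LinearMap.ker_eq_top,
    ← ker_pow_eq_of_le (ker_pow_ascent A) (le_max_left _ k), ← toEuclideanLin_pow,
    pow_eq_zero_of_le (le_max_right _ k) h, map_zero, LinearMap.ker_zero]

/-! ### The Jordan block and unitary similarity to it. -/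

theorem jordanBlock_pow_apply (k : ℕ) (i j : Fin n) :
    (jordanBlock n ^ k) i j = if (i : ℕ) + k = j then 1 else 0 := by
  have hJ (i j : Fin n) : jordanBlock n i j = if (i : ℕ) + 1 = j then 1 else 0 := rfl
  induction k generalizing j with
  | zero => simp [Matrix.one_apply, Fin.ext_iff]
  | succ k ih =>
    simp only [pow_succ, Matrix.mul_apply, ih, hJ]
    split_ifs with h
    · rw [Finset.sum_eq_single (⟨i + k, by omega⟩ : Fin n)]
      · simp [← h, add_assoc]
      · intro l _ hl
        rw [if_neg (fun h' => hl (Fin.ext h'.symm)), zero_mul]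
      · simp
    · refine Finset.sum_eq_zero fun l _ => ?_
      split_ifs <;> first | omega | simp

theorem jordanBlock_pow_self (n : ℕ) : jordanBlock n ^ n = 0 := by
  ext i j
  rw [jordanBlock_pow_apply, if_neg (by omega), Matrix.zero_apply]

theorem UnitarilySimilar.pow {B : Matrix (Fin n) (Fin n) ℂ} (h : UnitarilySimilar A B) (k : ℕ) :
    UnitarilySimilar (A ^ k) (B ^ k) := by
  obtain ⟨U, hU, rfl⟩ := h
  refine ⟨U, hU, ?_⟩
  have h1 : star U * U = 1 := Matrix.mem_unitaryGroup_iff'.1 hU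
  induction k with
  | zero => simp [Matrix.mem_unitaryGroup_iff.1 hU]
  | succ k ih =>
    rw [pow_succ, ih, pow_succ]
    calc U * B ^ k * star U * (U * B * star U) = U * B ^ k * (star U * U) * B * star U := by
          simp only [mul_assoc]
      _ = _ := by rw [h1]; simp only [mul_assoc, one_mul]

/-- A matrix that shifts an orthonormal basis backwards is unitarily similar to the nilpotent Jordan
block. -/
theorem unitarilySimilar_jordanBlock {b : Fin n → EuclideanSpace ℂ (Fin n)} (hb : Orthonormal ℂ b)
    (h0 : ∀ k : Fin n, (k : ℕ) = 0 → Matrix.toEuclideanLin A (b k) = 0)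
    (h1 : ∀ l k : Fin n, (l : ℕ) + 1 = k → Matrix.toEuclideanLin A (b k) = b l) :
    UnitarilySimilar A (jordanBlock n) := by
  set U : Matrix (Fin n) (Fin n) ℂ := Matrix.of fun i k => b k i with hUdef
  have hU : U ∈ Matrix.unitaryGroup (Fin n) ℂ := by
    rw [Matrix.mem_unitaryGroup_iff']
    ext j k
    rw [Matrix.one_apply, ← orthonormal_iff_ite.1 hb j k]
    simp [U, Matrix.mul_apply, PiLp.inner_apply, mul_comm]
  have hAU : A * U = U * jordanBlock n := by
    ext i k
    have hl : (A * U) i k = Matrix.toEuclideanLin A (b k) i := by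
      simp [U, Matrix.mul_apply, Matrix.mulVec, dotProduct]
    rw [hl, Matrix.mul_apply]
    simp only [jordanBlock, U, Matrix.of_apply, mul_ite, mul_one, mul_zero]
    rcases Nat.eq_zero_or_pos (k : ℕ) with hk | hk
    · rw [h0 k hk, Finset.sum_eq_zero]
      · rfl
      · intro l _
        rw [if_neg (by omega)]
    · obtain ⟨l, hl⟩ : ∃ l : Fin n, (l : ℕ) + 1 = k := ⟨⟨k - 1, by omega⟩, by simp; omega⟩
      rw [h1 l k hl, Finset.sum_eq_single l, if_pos hl]
      · intro l' _ hne
        rw [if_neg (fun h => hne (Fin.ext (by omega)))]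
      · simp
  refine ⟨U, hU, ?_⟩
  rw [← hAU, mul_assoc, Matrix.mem_unitaryGroup_iff.1 hU, mul_one]

theorem IsClassS.unitarilySimilar_jordanBlock (hS : IsClassS A) (hA : ¬ IsUnit A)
    (h : A ^ ascent A = 0) : UnitarilySimilar A (jordanBlock n) := by
  have han := hS.ascent_eq hA h
  -- Defect rank one excludes `n = 0`.
  obtain ⟨m, rfl⟩ : ∃ m, n = m + 1 := ⟨_, hS.finrank_isometricPart.symm⟩
  rw [han] at h
  set T := Matrix.toEuclideanLin A with hT
  have hT0 : T ^ (m + 1) = 0 := by rw [hT, ← toEuclideanLin_pow, h, map_zero]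
  have hfr : finrank ℂ (isometricPart (T ^ m)) = 1 := by
    have h1 := hS.finrank_ker_pow hA (j := m) (by omega)
    have h2 := (LinearMap.ker (T ^ m)).finrank_add_finrank_orthogonal
    rw [finrank_euclideanSpace_fin, h1] at h2
    have h3 : isometricPart (T ^ m) = (LinearMap.ker (T ^ m))ᗮ :=
      hS.isometricPart_pow hA (by omega)
    rw [h3]
    omega
  have : Nontrivial (isometricPart (T ^ m)) := Module.nontrivial_of_finrank_pos (R := ℂ) (by omega)
  obtain ⟨x, hx⟩ := exists_norm_eq (isometricPart (T ^ m)) zero_le_one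
  -- `T` raises the orbit index while the Jordan block lowers the basis index, so the basis is `b k
  -- = T ^ (m - k) x`.
  have ho := (orthonormal_orbit hS.norm_le hT0 x.2 hx).comp Fin.rev Fin.rev_injective
  refine PPI.unitarilySimilar_jordanBlock ho (fun k hk => ?_) (fun l k hlk => ?_)
  · simp only [Function.comp_apply, Fin.val_rev]
    rw [← hT, ← Module.End.mul_apply, ← pow_succ', hk, show m + 1 - (0 + 1) + 1 = m + 1 by omega,
      hT0, LinearMap.zero_apply]
  · simp only [Function.comp_apply, Fin.val_rev]
    rw [← hT, ← Module.End.mul_apply, ← pow_succ']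
    congr 2
    omega

end Matrix

end PPI

theorem proposition3p1 (n : ℕ) (A : Matrix (Fin n) (Fin n) ℂ)
    (hS : PPI.IsClassS A) (hA : ¬ IsUnit A) :
    PPI.ascent A = A.charpoly.rootMultiplicity 0 ∧
    (PPI.ppiIndex A = (PPI.ascent A : ℕ∞) ∨ PPI.ppiIndex A = ⊤) ∧
    (PPI.ppiIndex A = ⊤ ↔ PPI.UnitarilySimilar A (PPI.jordanBlock n)) ∧
    (∀ j : ℕ, 1 ≤ j → j ≤ PPI.ascent A → ((A ^ j).rank : ℤ) = (n : ℤ) - (j : ℤ)) := by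
  refine ⟨?_, ?_, ⟨fun h => ?_, fun h => ?_⟩, fun j _ hj => ?_⟩
  · rw [← PPI.charpoly_toEuclideanLin,
      PPI.rootMultiplicity_zero_charpoly_eq (PPI.ker_pow_ascent A), hS.finrank_ker_pow hA le_rfl]
  · by_cases hp : PPI.IsPartialIsometry (A ^ (PPI.ascent A + 1))
    · exact Or.inr (PPI.ppiIndex_eq_top_iff.2
        (hS.forall_isPartialIsometry_pow hA (hS.pow_ascent_eq_zero hA hp)))
    · refine Or.inl (le_antisymm (sSup_le ?_)
        (le_sSup ⟨_, rfl, fun j hj => hS.isPartialIsometry_pow hA hj⟩))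
      rintro _ ⟨k, rfl, hk⟩
      by_contra hlt
      exact hp (hk _ (by exact_mod_cast not_le.1 hlt))
  · exact hS.unitarilySimilar_jordanBlock hA
      (hS.pow_ascent_eq_zero hA (PPI.ppiIndex_eq_top_iff.1 h _))
  -- Similarity to the Jordan block is used only through nilpotency, `A ^ n = 0`.
  · obtain ⟨U, -, hU⟩ := h.pow n
    rw [PPI.jordanBlock_pow_self, mul_zero, zero_mul] at hU
    exact PPI.ppiIndex_eq_top_iff.2
      (hS.forall_isPartialIsometry_pow hA (PPI.pow_ascent_eq_zero_of_pow_eq_zero hU))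
  · have h1 := LinearMap.finrank_range_add_finrank_ker (Matrix.toEuclideanLin A ^ j)
    rw [hS.finrank_ker_pow hA hj, finrank_euclideanSpace_fin, ← PPI.toEuclideanLin_pow,
      ← PPI.rank_eq_finrank_range_toEuclideanLin] at h1
    omega
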